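/- Let $N\ge 2$ be an integer, $\alpha\in(0,+\infty]$, and let $g:\mathbb R\to\mathbb R$ be continuous and odd, positive on $(0,\alpha)$, negative on $(\alpha,+\infty)$, differentiable at $0$ with $g'(0)>0$. For $\xi\in\mathbb R$ consider the Cauchy problem $$-\left(\frac{u'}{\sqrt{1-(u')^2}}\right)'-\frac{N-1}{r}\,\frac{u'}{\sqrt{1-(u')^2}}=g(u)\quad (r>0),\qquad u(0)=\xi,\quad u'(0)=0. \tag{P}$$ A solution of (P) on $[0,R)$, $R\in(0,+\infty]$, is a function $u\in C^2([0,R))$ with $|u'|<1$ on $[0,R)$ that satisfies the initial conditions and satisfies the equation pointwise on $(0,R)$. Then for every $\xi\in\mathbb R$ there exist $R_\xi\in(0,+\infty]$ and a solution $u_\xi$ of (P) on $[0,R_\xi)$ which is maximal, i.e. is not the restriction of a solution of (P) on $[0,S)$ with $S>R_\xi$, such that: (i) if $|\xi|=\alpha\in\mathbb R$ or $\xi=0$, then $u_\xi\equiv\xi$ on $[0,R_\xi)$; (ii) if $\alpha\in\mathbb R$ and $|\xi|>\alpha$, then $|u_\xi|$ is strictly increasing on $[0,R_\xi)$ and $|u_\xi(r)|\to+\infty$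 as $r\to R_\xi^-$; (iii) if $0<|\xi|<\alpha$, then $R_\xi=+\infty$, and $u_\xi$ is oscillating (it has an unbounded sequence of zeros in $[0,+\infty)$) and localized ($u_\xi(r),u_\xi'(r),u_\xi''(r)\to0$ as $r\to+\infty$), with $\|u_\xi\|_{L^\infty([0,+\infty))}=|\xi|$. -/

import Mathlib

open Set Filter Topology MeasureTheory

/-- The half-open interval `[0, R)` of real numbers, with `R` an extended real number. -/
def halfOpen (R : EReal) : Set ℝ := {r : ℝ | 0 ≤ r ∧ (r : EReal) < R}

/-- The filter of real numbers `r` tending to `R` from the left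
(for `R = ⊤` this is `r → +∞`). -/
noncomputable def leftEnd (R : EReal) : Filter ℝ := comap (fun r : ℝ => (r : EReal)) (𝓝[<] R)

/-- The function `t ↦ t / √(1 - t²)`. -/
noncomputable def lorentzFlux (t : ℝ) : ℝ := t / √(1 - t ^ 2)

/-- `u` is a classical solution on `[0, R)`, `R ∈ (0, +∞]`, of the radial Cauchy problem
`-(u'/√(1-u'²))' - ((N-1)/r) u'/√(1-u'²) = g(u)` on `(0, R)`, `u(0) = ξ`, `u'(0) = 0`:
it is of class `C²` on `[0, R)` (one-sided at `0`), `|u'| < 1` on `[0, R)`, and the equation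
holds pointwise in `(0, R)`. -/
structure IsRadialSolution (N : ℕ) (g : ℝ → ℝ) (ξ : ℝ) (R : EReal) (u : ℝ → ℝ) : Prop where
  pos : 0 < R
  contDiffOn : ContDiffOn ℝ 2 u (halfOpen R)
  abs_deriv_lt_one : ∀ r ∈ halfOpen R, |derivWithin u (halfOpen R) r| < 1
  equation : ∀ r ∈ halfOpen R, 0 < r →
    -deriv (fun s => lorentzFlux (derivWithin u (halfOpen R) s)) r
      - ((N : ℝ) - 1) / r * lorentzFlux (derivWithin u (halfOpen R) r) = g (u r)
  value_zero : u 0 = ξ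
  deriv_zero : derivWithin u (halfOpen R) 0 = 0

/-- `u` is a solution on `[0, R)` and it is not the restriction of a solution on a larger interval
`[0, S)`. -/
def IsMaximalRadialSolution (N : ℕ) (g : ℝ → ℝ) (ξ : ℝ) (R : EReal) (u : ℝ → ℝ) : Prop :=
  IsRadialSolution N g ξ R u ∧
    ∀ (S : EReal) (v : ℝ → ℝ), R < S → IsRadialSolution N g ξ S v → ¬ EqOn v u (halfOpen R)

/-- `u : [0, +∞) → ℝ` is oscillating: it has an unbounded sequence of zeros. -/
def IsOscillating (u : ℝ → ℝ) : Prop :=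
  ∃ z : ℕ → ℝ, (∀ n, 0 ≤ z n ∧ u (z n) = 0) ∧ ¬ BddAbove (range z)

/-- `u : [0, +∞) → ℝ` is localized: it converges to zero at infinity together with its derivatives
up to order two. -/
def IsLocalized (u : ℝ → ℝ) : Prop :=
  ∀ k ≤ 2, Tendsto (iteratedDerivWithin k u (Ici 0)) atTop (𝓝 0)

/-! With the flux `w = u'/√(1-u'²)` as second unknown, the equation becomes `u' = fluxInv w`, `w' +
((N-1)/r) w = -g(u)`. Since `|fluxInv| < 1`, solutions cannot blow up in finite radius, so `R = ⊤`
works in every case and maximality is automatic. As `g` is merely continuous, existence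
(`exists_radialProfile`) comes from compactness: delayed equations are solved by iteration, and
their 1-Lipschitz solutions subconverge.

For `|ξ| = α` or `ξ = 0`, `g ξ = 0` and the constant is a solution. Otherwise `g` is truncated to
make its sign global, and an a priori bound shows that the solution never sees the truncation. Above
`α`, `r^(N-1) w` increases and `w` dominates a linear function as long as `u` stays bounded, so `u`
tends to infinity.

Below `α`, the energy `√(1+w²) - 1 + potential g u` decreases, which gives `|u| ≤ |ξ|`. Zeros recur
because the angle `arctan (-w/u)` would otherwise grow linearly (`not_eventually_pos`, where `g'(0)
> 0` enters through `k * s ≤ g s`). The energy tends to zero because otherwise a corrected energy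
would decrease logarithmically without bound (`exists_energy_lt`). -/

/-! ### The inverse flux function -/

/-- The inverse `w ↦ w / √(1 + w²)` of `lorentzFlux`. -/
noncomputable def fluxInv (w : ℝ) : ℝ := w / √(1 + w ^ 2)

lemma one_le_sqrt_one_add_sq (w : ℝ) : 1 ≤ √(1 + w ^ 2) := by
  rw [Real.one_le_sqrt]; nlinarith [sq_nonneg w]

lemma sqrt_one_add_sq_pos (w : ℝ) : 0 < √(1 + w ^ 2) :=
  one_pos.trans_le (one_le_sqrt_one_add_sq w)

lemma sq_sqrt_one_add_sq (w : ℝ) : √(1 + w ^ 2) ^ 2 = 1 + w ^ 2 :=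
  Real.sq_sqrt (by positivity)

lemma fluxInv_sq_lt_one (w : ℝ) : fluxInv w ^ 2 < 1 := by
  rw [fluxInv, div_pow, sq_sqrt_one_add_sq, div_lt_one (by positivity)]
  linarith

lemma abs_fluxInv_lt_one (w : ℝ) : |fluxInv w| < 1 :=
  (sq_lt_one_iff_abs_lt_one _).1 (fluxInv_sq_lt_one w)

@[simp] lemma fluxInv_zero : fluxInv 0 = 0 := by simp [fluxInv]

lemma fluxInv_neg (w : ℝ) : fluxInv (-w) = -fluxInv w := by
  simp [fluxInv, neg_div]

lemma mul_fluxInv_nonneg (w : ℝ) : 0 ≤ w * fluxInv w := by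
  rw [fluxInv, mul_div_assoc']
  exact div_nonneg (mul_self_nonneg w) (Real.sqrt_nonneg _)

lemma lorentzFlux_fluxInv (w : ℝ) : lorentzFlux (fluxInv w) = w := by
  have h : 1 - fluxInv w ^ 2 = (√(1 + w ^ 2))⁻¹ ^ 2 := by
    rw [fluxInv, div_pow, inv_pow, sq_sqrt_one_add_sq]
    have : (1 + w ^ 2) ≠ 0 := by positivity
    field_simp
    ring
  have hp := sqrt_one_add_sq_pos w
  rw [lorentzFlux, h, Real.sqrt_sq (by positivity), fluxInv]
  field_simp

/-- Makes `√(1+w²) - 1` the kinetic term whose derivative along a profile cancels that of the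
potential. -/
lemma hasDerivAt_sqrt_one_add_sq (w : ℝ) :
    HasDerivAt (fun x : ℝ => √(1 + x ^ 2)) (fluxInv w) w := by
  have h : HasDerivAt (fun x : ℝ => 1 + x ^ 2) (2 * w) w := by
    simpa using (hasDerivAt_pow 2 w).const_add 1
  refine (h.sqrt (by positivity)).congr_deriv ?_
  rw [fluxInv, mul_div_mul_left _ _ two_ne_zero]

lemma contDiff_fluxInv {n : WithTop ℕ∞} : ContDiff ℝ n fluxInv := by
  unfold fluxInv
  refine contDiff_id.div (ContDiff.sqrt (by fun_prop) fun x => ?_) fun x => ?_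
  · positivity
  · exact (sqrt_one_add_sq_pos x).ne'

lemma continuous_fluxInv : Continuous fluxInv := (contDiff_fluxInv (n := 0)).continuous

lemma strictMono_fluxInv : StrictMono fluxInv := by
  refine strictMono_of_deriv_pos fun w => ?_
  have hp := sqrt_one_add_sq_pos w
  have h := (hasDerivAt_id w).div (hasDerivAt_sqrt_one_add_sq w) hp.ne'
  have h' : HasDerivAt fluxInv _ w := h
  rw [h'.deriv]
  refine div_pos ?_ (by positivity)
  have : w * fluxInv w < √(1 + w ^ 2) := by
    rw [fluxInv, mul_div_assoc', div_lt_iff₀ hp]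
    nlinarith [sq_sqrt_one_add_sq w]
  simpa using this

lemma fluxInv_pos {w : ℝ} (hw : 0 < w) : 0 < fluxInv w := by
  simpa using strictMono_fluxInv hw

/-! ### Radial averages and the linear flux equation -/

/-- The mean `∫₀¹ τ^(N-1) f(rτ) dτ = r^(-N) ∫₀ʳ t^(N-1) f(t) dt`. -/
noncomputable def radialMean (N : ℕ) (f : ℝ → ℝ) (r : ℝ) : ℝ :=
  ∫ τ in (0 : ℝ)..1, τ ^ (N - 1) * f (r * τ)

/-- The solution `-r^(1-N) ∫₀ʳ t^(N-1) f(t) dt` of `w' + ((N-1)/r) w = -f`, `w(0) = 0`. -/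
noncomputable def radialFlux (N : ℕ) (f : ℝ → ℝ) (r : ℝ) : ℝ := -r * radialMean N f r

lemma continuous_radialMean (N : ℕ) {f : ℝ → ℝ} (hf : Continuous f) :
    Continuous (radialMean N f) := by
  unfold radialMean
  exact intervalIntegral.continuous_parametric_intervalIntegral_of_continuous'
    (by fun_prop) _ _

lemma continuous_radialFlux (N : ℕ) {f : ℝ → ℝ} (hf : Continuous f) :
    Continuous (radialFlux N f) := continuous_neg.mul (continuous_radialMean N hf)

lemma pow_mul_radialMean {N : ℕ} (hN : 1 ≤ N) (f : ℝ → ℝ) (r : ℝ) :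
    r ^ N * radialMean N f r = ∫ t in (0 : ℝ)..r, t ^ (N - 1) * f t := by
  have h := intervalIntegral.mul_integral_comp_mul_left (a := 0) (b := 1)
    (f := fun t : ℝ => t ^ (N - 1) * f t) r
  rw [mul_zero, mul_one] at h
  rw [← h, radialMean]
  obtain ⟨n, rfl⟩ : ∃ n, N = n + 1 := ⟨N - 1, by omega⟩
  simp only [Nat.add_sub_cancel, mul_pow]
  rw [pow_succ', mul_assoc, ← intervalIntegral.integral_const_mul]
  simp only [mul_assoc]

lemma radialMean_zero {N : ℕ} (hN : 1 ≤ N) (f : ℝ → ℝ) : radialMean N f 0 = f 0 / N := by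
  simp only [radialMean, zero_mul, intervalIntegral.integral_mul_const, integral_pow]
  obtain ⟨n, rfl⟩ : ∃ n, N = n + 1 := ⟨N - 1, by omega⟩
  simp
  ring

/-- Written with the mean, the formula has no singularity, so the flux is C¹ across the origin. At
`0` the slope is `-radialMean N f`, and the two expressions agree because the mean there is `f 0 /
N`. -/
lemma hasDerivAt_radialFlux {N : ℕ} (hN : 1 ≤ N) {f : ℝ → ℝ} (hf : Continuous f) (r : ℝ) :
    HasDerivAt (radialFlux N f) (-f r + ((N : ℝ) - 1) * radialMean N f r) r := by
  rcases eq_or_ne r 0 with rfl | hr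
  · have hN0 : (N : ℝ) ≠ 0 := by positivity
    have h1 : -f 0 + ((N : ℝ) - 1) * radialMean N f 0 = -radialMean N f 0 := by
      rw [radialMean_zero hN]; field_simp; ring
    rw [h1, hasDerivAt_iff_tendsto_slope]
    have h2 : Tendsto (fun x => -radialMean N f x) (𝓝[≠] 0) (𝓝 (-radialMean N f 0)) :=
      ((continuous_radialMean N hf).neg.tendsto 0).mono_left nhdsWithin_le_nhds
    refine h2.congr' ?_
    filter_upwards [self_mem_nhdsWithin] with x hx
    have hx : x ≠ 0 := hx
    simp only [slope_def_field, radialFlux]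
    field_simp
    ring
  · have h1 : HasDerivAt (fun x => ∫ t in (0 : ℝ)..x, t ^ (N - 1) * f t) (r ^ (N - 1) * f r) r :=
      (Continuous.integral_hasStrictDerivAt (by fun_prop) 0 r).hasDerivAt
    have h2 := (h1.neg.div (hasDerivAt_pow (N - 1) r) (pow_ne_zero _ hr))
    have h3 : radialFlux N f =ᶠ[𝓝 r]
        fun x => -(∫ t in (0 : ℝ)..x, t ^ (N - 1) * f t) / x ^ (N - 1) := by
      filter_upwards [isOpen_ne.mem_nhds hr] with x hx
      have hx : x ≠ 0 := hx
      rw [← pow_mul_radialMean hN, radialFlux]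
      obtain ⟨n, rfl⟩ : ∃ n, N = n + 1 := ⟨N - 1, by omega⟩
      simp only [Nat.add_sub_cancel]
      field_simp
      ring
    refine HasDerivAt.congr_of_eventuallyEq ?_ h3
    refine h2.congr_deriv ?_
    change (_ - -(∫ t in (0 : ℝ)..r, t ^ (N - 1) * f t) * _) / _ = _
    rw [← pow_mul_radialMean hN]
    -- The derivative of `x ^ (N - 1)` carries the exponent `N - 1 - 1`, truncated when `N = 1`.
    rcases (show N = 1 ∨ ∃ n, N = n + 2 from by
      rcases N with _ | _ | n
      · omega
      · left; rfl
      · right; exact ⟨n, rfl⟩) with rfl | ⟨n, rfl⟩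
    · simp
    · simp only [show n + 2 - 1 = n + 1 by omega, Nat.add_sub_cancel]
      push_cast
      field_simp
      ring

lemma contDiff_radialFlux {N : ℕ} (hN : 1 ≤ N) {f : ℝ → ℝ} (hf : Continuous f) :
    ContDiff ℝ 1 (radialFlux N f) := by
  rw [contDiff_one_iff_deriv]
  refine ⟨fun r => (hasDerivAt_radialFlux hN hf r).differentiableAt, ?_⟩
  rw [funext fun r => (hasDerivAt_radialFlux hN hf r).deriv]
  exact hf.neg.add (continuous_const.mul (continuous_radialMean N hf))

lemma halfOpen_top : halfOpen ⊤ = Ici (0 : ℝ) := by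
  ext r; simp [halfOpen, EReal.coe_lt_top]

/-! ### Profiles: the first order system -/

/-- `u` together with its flux `w = u'/√(1-u'²)` solves the radial Cauchy problem on `[0, ∞)`,
written as a first order system. -/
structure RadialProfile (N : ℕ) (g : ℝ → ℝ) (ξ : ℝ) (u w : ℝ → ℝ) : Prop where
  value_zero : u 0 = ξ
  flux_zero : w 0 = 0
  hasDerivAt : ∀ r, HasDerivAt u (fluxInv (w r)) r
  contDiff_flux : ContDiff ℝ 1 w
  hasDerivAt_flux : ∀ r, 0 < r → HasDerivAt w (-g (u r) - ((N : ℝ) - 1) / r * w r) r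

namespace RadialProfile

variable {N : ℕ} {g : ℝ → ℝ} {ξ : ℝ} {u w : ℝ → ℝ}

/-- Used to undo a truncation of `g` once the range of `u` is known. -/
lemma congr (h : RadialProfile N g ξ u w) {g' : ℝ → ℝ} (hg : ∀ r, 0 ≤ r → g' (u r) = g (u r)) :
    RadialProfile N g' ξ u w where
  __ := h
  hasDerivAt_flux r hr := by rw [hg r hr.le]; exact h.hasDerivAt_flux r hr

lemma neg (h : RadialProfile N g ξ u w) (hg : ∀ s, g (-s) = -g s) :
    RadialProfile N g (-ξ) (-u) (-w) where
  value_zero := by simp [h.value_zero]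
  flux_zero := by simp [h.flux_zero]
  hasDerivAt r := by
    simpa [fluxInv_neg] using (h.hasDerivAt r).neg
  contDiff_flux := h.contDiff_flux.neg
  hasDerivAt_flux r hr := by
    refine (h.hasDerivAt_flux r hr).neg.congr_deriv ?_
    rw [Pi.neg_apply, Pi.neg_apply, hg]
    ring

lemma differentiable (h : RadialProfile N g ξ u w) : Differentiable ℝ u :=
  fun r => (h.hasDerivAt r).differentiableAt

lemma continuous (h : RadialProfile N g ξ u w) : Continuous u := h.differentiable.continuous

lemma continuous_flux (h : RadialProfile N g ξ u w) : Continuous w := h.contDiff_flux.continuous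

lemma deriv_eq (h : RadialProfile N g ξ u w) : deriv u = fun r => fluxInv (w r) :=
  funext fun r => (h.hasDerivAt r).deriv

lemma contDiff (h : RadialProfile N g ξ u w) : ContDiff ℝ 2 u := by
  rw [show (2 : WithTop ℕ∞) = 1 + 1 by norm_num, contDiff_succ_iff_deriv]
  refine ⟨h.differentiable, by simp, ?_⟩
  rw [h.deriv_eq]
  exact contDiff_fluxInv.comp h.contDiff_flux

lemma derivWithin_eq (h : RadialProfile N g ξ u w) {r : ℝ} (hr : 0 ≤ r) :
    derivWithin u (Ici 0) r = fluxInv (w r) :=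
  (h.hasDerivAt r).hasDerivWithinAt.derivWithin (uniqueDiffOn_Ici 0 r hr)

lemma isRadialSolution (h : RadialProfile N g ξ u w) : IsRadialSolution N g ξ ⊤ u where
  pos := EReal.zero_lt_top
  contDiffOn := h.contDiff.contDiffOn
  abs_deriv_lt_one r hr := by
    rw [halfOpen_top] at hr ⊢
    rw [h.derivWithin_eq hr]
    exact abs_fluxInv_lt_one _
  equation r _ hr := by
    rw [halfOpen_top, h.derivWithin_eq hr.le, lorentzFlux_fluxInv]
    have he : (fun s => lorentzFlux (derivWithin u (Ici 0) s)) =ᶠ[𝓝 r] w := by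
      filter_upwards [Ioi_mem_nhds hr] with s hs
      rw [h.derivWithin_eq (le_of_lt hs), lorentzFlux_fluxInv]
    rw [he.deriv_eq, (h.hasDerivAt_flux r hr).deriv]
    ring
  value_zero := h.value_zero
  deriv_zero := by
    rw [halfOpen_top, h.derivWithin_eq le_rfl, h.flux_zero, fluxInv_zero]

lemma isMaximalRadialSolution (h : RadialProfile N g ξ u w) :
    IsMaximalRadialSolution N g ξ ⊤ u :=
  ⟨h.isRadialSolution, fun _ _ hS => absurd hS not_top_lt⟩

end RadialProfile

lemma radialProfile_const {N : ℕ} {g : ℝ → ℝ} {ξ : ℝ} (hξ : g ξ = 0) :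
    RadialProfile N g ξ (fun _ => ξ) 0 where
  value_zero := rfl
  flux_zero := rfl
  hasDerivAt r := by rw [Pi.zero_apply, fluxInv_zero]; exact hasDerivAt_const r ξ
  contDiff_flux := contDiff_const
  hasDerivAt_flux r _ := by
    simp only [hξ, Pi.zero_apply, neg_zero, mul_zero, sub_zero]
    exact hasDerivAt_const r 0

lemma leftEnd_top : leftEnd ⊤ = atTop := by
  have h : Iio (⊤ : EReal) = {⊤}ᶜ := by ext x; simp [lt_top_iff_ne_top]
  rw [leftEnd, h, EReal.nhdsWithin_top, comap_map EReal.coe_injective]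

/-! ### Existence by delay and compactness -/

/-- The integral operator whose fixed points for `δ = 0` are the profiles; for `δ > 0` the
nonlinearity is evaluated with delay `δ`. -/
noncomputable def delayMap (N : ℕ) (g : ℝ → ℝ) (ξ δ : ℝ) (u : ℝ → ℝ) (r : ℝ) : ℝ :=
  ξ + ∫ s in (0 : ℝ)..r, fluxInv (radialFlux N (fun t => g (u (max (|t| - δ) 0))) s)

section delayMap

variable {N : ℕ} {g : ℝ → ℝ} {ξ δ : ℝ} {u v : ℝ → ℝ}

lemma delayMap_zero : delayMap N g ξ δ u 0 = ξ := by simp [delayMap]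

lemma continuous_fluxInv_radialFlux_delay (hg : Continuous g) (hu : Continuous u) :
    Continuous fun s => fluxInv (radialFlux N (fun t => g (u (max (|t| - δ) 0))) s) :=
  continuous_fluxInv.comp (continuous_radialFlux N (by fun_prop))

lemma hasDerivAt_delayMap (hg : Continuous g) (hu : Continuous u) (r : ℝ) :
    HasDerivAt (delayMap N g ξ δ u)
      (fluxInv (radialFlux N (fun t => g (u (max (|t| - δ) 0))) r)) r :=
  ((continuous_fluxInv_radialFlux_delay hg hu).integral_hasStrictDerivAt 0 r).hasDerivAt.const_add ξ

lemma lipschitzWith_delayMap (hg : Continuous g) (hu : Continuous u) :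
    LipschitzWith 1 (delayMap N g ξ δ u) := by
  refine lipschitzWith_of_nnnorm_deriv_le
    (fun r => (hasDerivAt_delayMap hg hu r).differentiableAt) fun r => ?_
  rw [(hasDerivAt_delayMap hg hu r).deriv]
  exact (abs_fluxInv_lt_one _).le

lemma radialMean_congr {f₁ f₂ : ℝ → ℝ} {r : ℝ} (h : ∀ t, |t| ≤ |r| → f₁ t = f₂ t) :
    radialMean N f₁ r = radialMean N f₂ r := by
  refine intervalIntegral.integral_congr fun τ hτ => ?_
  rw [uIcc_of_le zero_le_one] at hτ
  have : |r * τ| ≤ |r| := by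
    rw [abs_mul, abs_of_nonneg hτ.1]
    exact mul_le_of_le_one_right (abs_nonneg r) hτ.2
  simp only [h _ this]

lemma abs_le_abs_of_mem_uIcc_zero {s r : ℝ} (hs : s ∈ uIcc 0 r) : |s| ≤ |r| := by
  rcases le_total 0 r with h | h
  · rw [uIcc_of_le h] at hs
    rw [abs_of_nonneg hs.1, abs_of_nonneg h]; exact hs.2
  · rw [uIcc_of_ge h] at hs
    rw [abs_of_nonpos hs.2, abs_of_nonpos h]; exact neg_le_neg hs.1

/-- The delay gains a length `δ`: the image up to radius `ρ + δ` only reads the argument up to `ρ`.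
-/
lemma delayMap_congr {ρ r : ℝ} (hρ : 0 ≤ ρ) (h : ∀ x, |x| ≤ ρ → u x = v x) (hr : |r| ≤ ρ + δ) :
    delayMap N g ξ δ u r = delayMap N g ξ δ v r := by
  rw [delayMap, delayMap]
  congr 1
  refine intervalIntegral.integral_congr fun s hs => ?_
  have hs := abs_le_abs_of_mem_uIcc_zero hs
  simp only [radialFlux]
  rw [radialMean_congr fun t ht => ?_]
  rw [h]
  rw [abs_of_nonneg (le_max_right _ _)]
  exact max_le (by linarith) hρ

/-- Method of steps: each iteration settles the values on a further interval of length `δ`. -/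
lemma delayMap_iterate_succ (hδ : 0 ≤ δ) (m : ℕ) : ∀ r, |r| ≤ m * δ →
    (delayMap N g ξ δ)^[m + 1] (fun _ => ξ) r = (delayMap N g ξ δ)^[m] (fun _ => ξ) r := by
  induction m with
  | zero =>
    intro r hr
    have : r = 0 := by simpa using hr
    simp [this, delayMap_zero]
  | succ m ih =>
    intro r hr
    rw [Function.iterate_succ_apply', Function.iterate_succ_apply' _ m]
    refine delayMap_congr (ρ := m * δ) (by positivity)
      (fun x hx => (congrFun (Function.iterate_succ_apply' _ m _).symm x).trans (ih x hx)) ?_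
    push_cast at hr
    linarith

lemma exists_delayMap_eq (N : ℕ) (hg : Continuous g) (ξ : ℝ) (hδ : 0 < δ) (R : ℝ) :
    ∃ u : ℝ → ℝ, LipschitzWith 1 u ∧ u 0 = ξ ∧ ∀ r, |r| ≤ R → delayMap N g ξ δ u r = u r := by
  obtain ⟨m, hm⟩ := exists_nat_ge (R / δ)
  rw [div_le_iff₀ hδ] at hm
  refine ⟨(delayMap N g ξ δ)^[m] fun _ => ξ, ?_, ?_, fun r hr => ?_⟩
  · clear hm
    induction m with
    | zero => exact LipschitzWith.const' ξ
    | succ m ih =>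
      rw [Function.iterate_succ_apply']
      exact lipschitzWith_delayMap hg ih.continuous
  · cases m with
    | zero => rfl
    | succ m => rw [Function.iterate_succ_apply', delayMap_zero]
  · rw [← delayMap_iterate_succ hδ.le m r (hr.trans hm), Function.iterate_succ_apply']

end delayMap

lemma LipschitzWith.abs_sub_le {u : ℝ → ℝ} (h : LipschitzWith 1 u) (x y : ℝ) :
    |u x - u y| ≤ |x - y| := by
  simpa [Real.dist_eq] using h.dist_le_mul x y

/-- Arzelà–Ascoli for `1`-Lipschitz functions on the line, in pointwise form. -/
lemma exists_subseq_tendsto_of_lipschitzWith_one {u : ℕ → ℝ → ℝ} {ξ : ℝ}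
    (hu : ∀ n, LipschitzWith 1 (u n)) (h0 : ∀ n, u n 0 = ξ) :
    ∃ (v : ℝ → ℝ) (φ : ℕ → ℕ), StrictMono φ ∧ LipschitzWith 1 v ∧
      ∀ r, Tendsto (fun n => u (φ n) r) atTop (𝓝 (v r)) := by
  -- Tychonoff on the rationals replaces the diagonal argument; the Lipschitz bound then carries
  -- convergence to every real.
  have hK : IsCompact (univ.pi fun q : ℚ => Icc (ξ - |(q : ℝ)|) (ξ + |(q : ℝ)|)) :=
    isCompact_univ_pi fun _ => isCompact_Icc
  obtain ⟨a, -, φ, hφ, ha⟩ := hK.tendsto_subseq (x := fun n (q : ℚ) => u n q) (by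
    intro n q _
    have := (hu n).abs_sub_le q 0
    rw [h0, sub_zero, abs_le] at this
    constructor <;> linarith [this.1, this.2])
  have hlim : ∀ r, ∃ l, Tendsto (fun n => u (φ n) r) atTop (𝓝 l) := by
    intro r
    refine cauchySeq_tendsto_of_complete (Metric.cauchySeq_iff.2 fun ε hε => ?_)
    obtain ⟨q, hq1, hq2⟩ := exists_rat_btwn (show r < r + ε / 4 by linarith)
    have hq := (tendsto_pi_nhds.1 ha q).cauchySeq
    obtain ⟨n₀, hn⟩ := Metric.cauchySeq_iff.1 hq (ε / 4) (by linarith)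
    refine ⟨n₀, fun m hm n hn' => ?_⟩
    have h1 := hn m hm n hn'
    have h2 := (hu (φ m)).abs_sub_le r q
    have h3 := (hu (φ n)).abs_sub_le r q
    have h4 : |r - q| < ε / 4 := by rw [abs_lt]; constructor <;> linarith
    simp only [Function.comp_apply, Real.dist_eq] at h1 ⊢
    rw [abs_lt] at h1 h4 ⊢
    rw [abs_le] at h2 h3
    have h5 := abs_lt.2 h4
    constructor <;> linarith [h1.1, h1.2, h2.1, h2.2, h3.1, h3.2]
  choose v hv using hlim
  refine ⟨v, φ, hφ, LipschitzWith.of_dist_le_mul fun x y => ?_, hv⟩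
  exact le_of_tendsto ((hv x).dist (hv y)) (Eventually.of_forall fun n => (hu _).dist_le_mul x y)

lemma tendsto_radialMean {N : ℕ} {f : ℕ → ℝ → ℝ} {f' : ℝ → ℝ} {r C : ℝ}
    (hf : ∀ n, Continuous (f n)) (hC : ∀ n t, |t| ≤ |r| → |f n t| ≤ C)
    (h : ∀ t, Tendsto (fun n => f n t) atTop (𝓝 (f' t))) :
    Tendsto (fun n => radialMean N (f n) r) atTop (𝓝 (radialMean N f' r)) := by
  refine intervalIntegral.tendsto_integral_filter_of_dominated_convergence (fun _ => C) ?_ ?_ ?_ ?_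
  · refine Eventually.of_forall fun n => Continuous.aestronglyMeasurable ?_
    have := hf n
    fun_prop
  · refine Eventually.of_forall fun n => Eventually.of_forall fun τ hτ => ?_
    rw [uIoc_of_le zero_le_one] at hτ
    have h1 : |r * τ| ≤ |r| := by
      rw [abs_mul, abs_of_pos hτ.1]
      exact mul_le_of_le_one_right (abs_nonneg r) hτ.2
    rw [norm_mul, Real.norm_eq_abs, Real.norm_eq_abs, abs_of_nonneg (pow_nonneg hτ.1.le _)]
    exact (mul_le_of_le_one_left (abs_nonneg _) (pow_le_one₀ hτ.1.le hτ.2)).trans (hC n _ h1)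
  · exact intervalIntegrable_const
  · exact Eventually.of_forall fun τ _ => (h _).const_mul _

/-- Dominated convergence twice: the outer integrand is bounded by 1, and in the inner one `u n`
stays in a fixed compact interval around `ξ`, where `g` is bounded. -/
lemma tendsto_delayMap {N : ℕ} {g : ℝ → ℝ} (hg : Continuous g) {ξ : ℝ} {u : ℕ → ℝ → ℝ}
    {v : ℝ → ℝ} {δ : ℕ → ℝ} (hδ : Tendsto δ atTop (𝓝 0)) (hδ0 : ∀ n, 0 ≤ δ n)
    (hu : ∀ n, LipschitzWith 1 (u n)) (h0 : ∀ n, u n 0 = ξ)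
    (hv : ∀ r, Tendsto (fun n => u n r) atTop (𝓝 (v r))) (r : ℝ) :
    Tendsto (fun n => delayMap N g ξ (δ n) (u n) r) atTop (𝓝 (delayMap N g ξ 0 v r)) := by
  have hpt : ∀ t : ℝ, Tendsto (fun n => g (u n (max (|t| - δ n) 0))) atTop
      (𝓝 (g (v (max (|t| - 0) 0)))) := by
    intro t
    refine (hg.tendsto _).comp ?_
    have hx : Tendsto (fun n => max (|t| - δ n) 0) atTop (𝓝 (max (|t| - 0) 0)) :=
      (hδ.const_sub _).max tendsto_const_nhds
    have h1 : Tendsto (fun n => u n (max (|t| - δ n) 0) - u n (max (|t| - 0) 0)) atTop (𝓝 0) := by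
      refine squeeze_zero_norm (fun n => (hu n).abs_sub_le _ _) ?_
      simpa using (hx.sub_const (max (|t| - 0) 0)).abs
    simpa using h1.add (hv (max (|t| - 0) 0))
  refine Tendsto.const_add ξ ?_
  refine intervalIntegral.tendsto_integral_filter_of_dominated_convergence (fun _ => 1) ?_ ?_ ?_ ?_
  · exact Eventually.of_forall fun n =>
      (continuous_fluxInv_radialFlux_delay hg (hu n).continuous).aestronglyMeasurable
  · exact Eventually.of_forall fun n => Eventually.of_forall fun s _ => (abs_fluxInv_lt_one _).le
  · exact intervalIntegrable_const
  · refine Eventually.of_forall fun s _ => (continuous_fluxInv.tendsto _).comp ?_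
    obtain ⟨C, hC⟩ := (isCompact_Icc (a := ξ - |s|) (b := ξ + |s|)).exists_bound_of_continuousOn
      hg.continuousOn
    refine Tendsto.const_mul _ (tendsto_radialMean (C := C) (fun n => ?_) (fun n t ht => ?_) hpt)
    · have := (hu n).continuous
      fun_prop
    · refine hC _ ?_
      have h1 := (hu n).abs_sub_le (max (|t| - δ n) 0) 0
      rw [h0, sub_zero, abs_of_nonneg (le_max_right (|t| - δ n) 0), abs_le] at h1
      have h2 : max (|t| - δ n) 0 ≤ |s| := max_le (by linarith [hδ0 n]) (abs_nonneg s)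
      constructor <;> linarith [h1.1, h1.2]

theorem exists_radialProfile {N : ℕ} (hN : 1 ≤ N) {g : ℝ → ℝ} (hg : Continuous g) (ξ : ℝ) :
    ∃ u w : ℝ → ℝ, RadialProfile N g ξ u w := by
  have hδ : ∀ n : ℕ, (0 : ℝ) < 1 / ((n : ℝ) + 1) := fun n => by positivity
  choose u hu h0 hfix using fun n : ℕ => exists_delayMap_eq N hg ξ (hδ n) n
  obtain ⟨v, φ, hφ, hvl, hv⟩ := exists_subseq_tendsto_of_lipschitzWith_one hu h0
  have hv' : delayMap N g ξ 0 v = v := by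
    funext r
    refine tendsto_nhds_unique ?_ (hv r)
    refine (tendsto_delayMap (N := N) hg
      (tendsto_one_div_add_atTop_nhds_zero_nat.comp hφ.tendsto_atTop)
      (fun n => (hδ (φ n)).le) (fun n => hu (φ n)) (fun n => h0 (φ n)) hv r).congr' ?_
    obtain ⟨m, hm⟩ := exists_nat_ge |r|
    filter_upwards [eventually_ge_atTop m] with n hn
    -- The `n`-th approximation is a fixed point only for `|r| ≤ n`, which eventually covers any
    -- given `r`.
    exact hfix (φ n) r (hm.trans (by exact_mod_cast hn.trans (hφ.id_le n)))
  have hvc := hvl.continuous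
  have hf : Continuous fun t => g (v (max (|t| - 0) 0)) := by fun_prop
  refine ⟨v, radialFlux N fun t => g (v (max (|t| - 0) 0)), ?_, by simp [radialFlux],
    fun r => ?_, contDiff_radialFlux hN hf, fun r hr => ?_⟩
  · rw [← hv', delayMap_zero]
  · have := hasDerivAt_delayMap (N := N) (ξ := ξ) (δ := 0) hg hvc r
    rwa [hv'] at this
  · refine (hasDerivAt_radialFlux hN hf r).congr_deriv ?_
    simp only [sub_zero, abs_of_pos hr, max_eq_left hr.le, radialFlux]
    field_simp
    ring

/-! ### Monotone unbounded profiles -/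

namespace RadialProfile

variable {N : ℕ} {g : ℝ → ℝ} {ξ : ℝ} {u w : ℝ → ℝ}

lemma hasDerivAt_pow_mul_flux (h : RadialProfile N g ξ u w) (hN : 2 ≤ N) {r : ℝ} (hr : 0 < r) :
    HasDerivAt (fun r => r ^ (N - 1) * w r) (-(r ^ (N - 1) * g (u r))) r := by
  refine ((hasDerivAt_pow (N - 1) r).mul (h.hasDerivAt_flux r hr)).congr_deriv ?_
  obtain ⟨n, rfl⟩ : ∃ n, N = n + 2 := ⟨N - 2, by omega⟩
  simp only [show n + 2 - 1 = n + 1 by omega, Nat.add_sub_cancel]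
  push_cast
  field_simp
  ring

lemma flux_pos (h : RadialProfile N g ξ u w) (hN : 2 ≤ N) (hg : ∀ s, g s < 0) {r : ℝ}
    (hr : 0 < r) : 0 < w r := by
  have hmono : StrictMonoOn (fun r => r ^ (N - 1) * w r) (Ici 0) := by
    refine strictMonoOn_of_deriv_pos (convex_Ici 0)
      ((continuous_pow _).mul h.continuous_flux).continuousOn fun x hx => ?_
    rw [interior_Ici] at hx
    have hx : 0 < x := hx
    rw [(h.hasDerivAt_pow_mul_flux hN hx).deriv, ← mul_neg]
    exact mul_pos (pow_pos hx _) (neg_pos.2 (hg _))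
  have := hmono self_mem_Ici hr.le hr
  simp only [h.flux_zero, mul_zero] at this
  exact pos_of_mul_pos_right this (pow_nonneg hr.le _)

/-- `r^(N-1) w` grows at least as fast as `(c/N) r^N`, by comparing derivatives. -/
lemma flux_ge (h : RadialProfile N g ξ u w) (hN : 2 ≤ N) {c : ℝ}
    (hc : ∀ r, 0 < r → g (u r) ≤ -c) {r : ℝ} (hr : 0 < r) : c / N * r ≤ w r := by
  have hN0 : (N : ℝ) ≠ 0 := by positivity
  have hd : ∀ x, 0 < x → HasDerivAt (fun r => r ^ (N - 1) * w r - c / N * r ^ N)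
      (-(x ^ (N - 1) * g (u x)) - c * x ^ (N - 1)) x := fun x hx =>
    ((h.hasDerivAt_pow_mul_flux hN hx).sub ((hasDerivAt_pow N x).const_mul (c / N))).congr_deriv
      (by field_simp)
  have hmono : MonotoneOn (fun r => r ^ (N - 1) * w r - c / N * r ^ N) (Ici 0) := by
    refine monotoneOn_of_deriv_nonneg (convex_Ici 0) (Continuous.continuousOn ?_) ?_ fun x hx => ?_
    · have := h.continuous_flux
      fun_prop
    · intro x hx
      rw [interior_Ici] at hx
      exact (hd x hx).differentiableAt.differentiableWithinAt
    · rw [interior_Ici] at hx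
      have hx : 0 < x := hx
      rw [(hd x hx).deriv]
      have := mul_le_mul_of_nonneg_left (hc x hx) (pow_nonneg hx.le (N - 1))
      linarith
  have h1 := hmono self_mem_Ici hr.le hr.le
  simp only [h.flux_zero, mul_zero, zero_pow (show N ≠ 0 by omega), sub_zero] at h1
  have h2 : r ^ N = r ^ (N - 1) * r := by rw [← pow_succ]; congr 1; omega
  rw [h2] at h1
  have h3 : r ^ (N - 1) * (c / N * r) ≤ r ^ (N - 1) * w r := by linarith
  exact le_of_mul_le_mul_left h3 (pow_pos hr _)

lemma strictMonoOn (h : RadialProfile N g ξ u w) (hN : 2 ≤ N) (hg : ∀ s, g s < 0) :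
    StrictMonoOn u (Ici 0) := by
  refine strictMonoOn_of_deriv_pos (convex_Ici 0) h.continuous.continuousOn fun x hx => ?_
  rw [interior_Ici] at hx
  rw [h.deriv_eq]
  exact fluxInv_pos (h.flux_pos hN hg hx)

lemma tendsto_atTop (h : RadialProfile N g ξ u w) (hN : 2 ≤ N) (hg : ∀ s, g s < 0)
    (hgc : Continuous g) : Tendsto u atTop atTop := by
  have hmono := (h.strictMonoOn hN hg).monotoneOn
  have hunb : ∀ M, ∃ r, 0 ≤ r ∧ M < u r := by
    by_contra! hM
    obtain ⟨M, hM⟩ := hM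
    -- If `u` stayed in `[ξ, M]`, `-g` would have a positive minimum there, so `u'` would be bounded
    -- below by a positive `d` on `[1, ∞)`.
    obtain ⟨s₀, hs₀, hmax⟩ := (isCompact_Icc (a := ξ) (b := M)).exists_isMaxOn
      ⟨ξ, le_rfl, h.value_zero ▸ hM 0 le_rfl⟩ hgc.continuousOn
    have hc : 0 < -g s₀ := neg_pos.2 (hg s₀)
    have hw : ∀ r, 0 < r → -g s₀ / N * r ≤ w r := fun r hr => by
      refine h.flux_ge hN (fun r hr => ?_) hr
      rw [neg_neg]
      exact hmax ⟨h.value_zero ▸ hmono self_mem_Ici hr.le hr.le, hM r hr.le⟩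
    have hd : 0 < fluxInv (-g s₀ / N) := fluxInv_pos (by positivity)
    set d := fluxInv (-g s₀ / N)
    have hlin : ∀ r, 1 ≤ r → d * (r - 1) ≤ u r - u 1 := fun r hr => by
      refine (convex_Ici (1 : ℝ)).mul_sub_le_image_sub_of_le_deriv h.continuous.continuousOn
        h.differentiable.differentiableOn (fun x hx => ?_) 1 self_mem_Ici r hr hr
      rw [interior_Ici] at hx
      have hx : 1 < x := hx
      rw [h.deriv_eq]
      refine strictMono_fluxInv.monotone (le_trans ?_ (hw x (by linarith)))
      exact le_mul_of_one_le_right (by positivity) hx.le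
    have h1 := hlin (1 + (M - u 1 + 1) / d) (by
      have := hM 1 zero_le_one
      have : 0 ≤ (M - u 1 + 1) / d := div_nonneg (by linarith) hd.le
      linarith)
    have h2 := hM (1 + (M - u 1 + 1) / d) (by
      have := hM 1 zero_le_one
      have : 0 ≤ (M - u 1 + 1) / d := div_nonneg (by linarith) hd.le
      linarith)
    have h3 : d * (1 + (M - u 1 + 1) / d - 1) = M - u 1 + 1 := by field_simp; ring
    linarith
  refine Filter.tendsto_atTop.2 fun M => ?_
  obtain ⟨r, hr, hMr⟩ := hunb M
  filter_upwards [eventually_ge_atTop r] with x hx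
  exact hMr.le.trans (hmono hr (hr.trans hx) hx)

end RadialProfile

/-- Profiles starting above the positive zero of `g` increase to infinity. -/
theorem exists_radialProfile_strictMonoOn {N : ℕ} (hN : 2 ≤ N) {g : ℝ → ℝ} (hgc : Continuous g)
    {ξ : ℝ} (hξ : 0 < ξ) (hg : ∀ s, ξ ≤ s → g s < 0) :
    ∃ u w : ℝ → ℝ, RadialProfile N g ξ u w ∧ (∀ r, 0 ≤ r → 0 < u r) ∧
      StrictMonoOn u (Ici 0) ∧ Tendsto u atTop atTop := by
  -- This truncation is negative everywhere, so the profile increases from `ξ` and never leaves the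
  -- region where it equals `g`.
  have hc : Continuous fun s => g (max s ξ) := by fun_prop
  have hneg : ∀ s, g (max s ξ) < 0 := fun s => hg _ (le_max_right _ _)
  obtain ⟨u, w, h⟩ := exists_radialProfile (show 1 ≤ N by omega) hc ξ
  have hmono := h.strictMonoOn hN hneg
  have hge : ∀ r, 0 ≤ r → ξ ≤ u r := fun r hr =>
    h.value_zero ▸ hmono.monotoneOn self_mem_Ici hr hr
  exact ⟨u, w, h.congr fun r hr => by rw [max_eq_left (hge r hr)],
    fun r hr => hξ.trans_le (hge r hr), hmono, h.tendsto_atTop hN hneg hc⟩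

/-! ### Potential and energy -/

section potential

variable {g : ℝ → ℝ}

/-- The primitive of `g` vanishing at `0`. -/
noncomputable def potential (g : ℝ → ℝ) (x : ℝ) : ℝ := ∫ t in (0 : ℝ)..x, g t

lemma hasDerivAt_potential (hg : Continuous g) (x : ℝ) : HasDerivAt (potential g) (g x) x :=
  (hg.integral_hasStrictDerivAt 0 x).hasDerivAt

lemma continuous_potential (hg : Continuous g) : Continuous (potential g) :=
  continuous_iff_continuousAt.2 fun x => (hasDerivAt_potential hg x).continuousAt

@[simp] lemma potential_zero : potential g 0 = 0 := by simp [potential]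

lemma potential_neg (hodd : ∀ s, g (-s) = -g s) (x : ℝ) : potential g (-x) = potential g x := by
  have h := intervalIntegral.integral_comp_neg (a := 0) (b := x) g
  simp only [hodd, intervalIntegral.integral_neg, neg_zero] at h
  rw [potential, potential, intervalIntegral.integral_symm, ← h, neg_neg]

lemma potential_abs (hodd : ∀ s, g (-s) = -g s) (x : ℝ) : potential g |x| = potential g x := by
  rcases abs_choice x with h | h <;> simp [h, potential_neg hodd]

lemma strictMonoOn_potential (hg : Continuous g) (hpos : ∀ s, 0 < s → 0 < g s) :
    StrictMonoOn (potential g) (Ici 0) := by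
  refine strictMonoOn_of_deriv_pos (convex_Ici 0) (continuous_potential hg).continuousOn
    fun x hx => ?_
  rw [interior_Ici] at hx
  rw [(hasDerivAt_potential hg x).deriv]
  exact hpos x hx

lemma potential_nonneg (hg : Continuous g) (hodd : ∀ s, g (-s) = -g s)
    (hpos : ∀ s, 0 < s → 0 < g s) (x : ℝ) : 0 ≤ potential g x := by
  rw [← potential_abs hodd, ← potential_zero (g := g)]
  exact (strictMonoOn_potential hg hpos).monotoneOn self_mem_Ici (abs_nonneg x) (abs_nonneg x)

lemma mul_self_pos_of_odd (hodd : ∀ s, g (-s) = -g s) (hpos : ∀ s, 0 < s → 0 < g s) {x : ℝ}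
    (hx : x ≠ 0) : 0 < x * g x := by
  rcases hx.lt_or_gt with h | h
  · have := hpos (-x) (by linarith)
    rw [hodd] at this
    exact mul_pos_of_neg_of_neg h (by linarith)
  · exact mul_pos h (hpos x h)

end potential

namespace RadialProfile

/-- The energy of a profile. -/
noncomputable def energy (g u w : ℝ → ℝ) (r : ℝ) : ℝ := √(1 + w r ^ 2) - 1 + potential g (u r)

variable {N : ℕ} {g : ℝ → ℝ} {ξ : ℝ} {u w : ℝ → ℝ}

lemma continuous_energy (h : RadialProfile N g ξ u w) (hgc : Continuous g) :
    Continuous (energy g u w) := by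
  have h1 := h.continuous
  have h2 := h.continuous_flux
  have h3 := continuous_potential hgc
  unfold energy
  fun_prop

/-- The two `g` terms cancel; only the friction from `(N-1)/r` remains. -/
lemma hasDerivAt_energy (h : RadialProfile N g ξ u w) (hgc : Continuous g) {r : ℝ} (hr : 0 < r) :
    HasDerivAt (energy g u w) (-(((N : ℝ) - 1) / r * (w r * fluxInv (w r)))) r := by
  have h1 := (hasDerivAt_sqrt_one_add_sq (w r)).comp r (h.hasDerivAt_flux r hr)
  have h2 := (hasDerivAt_potential hgc (u r)).comp r (h.hasDerivAt r)
  refine ((h1.sub_const 1).add h2).congr_deriv ?_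
  ring

lemma antitoneOn_energy (h : RadialProfile N g ξ u w) (hN : 1 ≤ N) (hgc : Continuous g) :
    AntitoneOn (energy g u w) (Ici 0) := by
  have hN1 : (1 : ℝ) ≤ N := by exact_mod_cast hN
  refine antitoneOn_of_deriv_nonpos (convex_Ici 0) (h.continuous_energy hgc).continuousOn
    (fun x hx => ?_) fun x hx => ?_ <;> rw [interior_Ici] at hx
  · exact (h.hasDerivAt_energy hgc hx).differentiableAt.differentiableWithinAt
  · have hx : 0 < x := hx
    rw [(h.hasDerivAt_energy hgc hx).deriv, neg_nonpos]
    exact mul_nonneg (div_nonneg (by linarith) hx.le) (mul_fluxInv_nonneg _)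

lemma energy_le (h : RadialProfile N g ξ u w) (hN : 1 ≤ N) (hgc : Continuous g) {r : ℝ}
    (hr : 0 ≤ r) : energy g u w r ≤ potential g ξ := by
  have := h.antitoneOn_energy hN hgc self_mem_Ici hr hr
  simpa [energy, h.flux_zero, h.value_zero] using this

lemma energy_nonneg (hgc : Continuous g) (hodd : ∀ s, g (-s) = -g s)
    (hpos : ∀ s, 0 < s → 0 < g s) (r : ℝ) : 0 ≤ energy g u w r := by
  have h1 := one_le_sqrt_one_add_sq (w r)
  have h2 := potential_nonneg hgc hodd hpos (u r)
  unfold energy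
  linarith

/-- The initial energy is purely potential, and the potential is even and strictly increasing in
`|u|`. -/
lemma abs_value_le (h : RadialProfile N g ξ u w) (hN : 1 ≤ N) (hgc : Continuous g)
    (hodd : ∀ s, g (-s) = -g s) (hpos : ∀ s, 0 < s → 0 < g s) {r : ℝ} (hr : 0 ≤ r) :
    |u r| ≤ |ξ| := by
  have h1 := h.energy_le hN hgc hr
  have h2 := one_le_sqrt_one_add_sq (w r)
  rw [← (strictMonoOn_potential hgc hpos).le_iff_le (mem_Ici.2 (abs_nonneg _))
      (mem_Ici.2 (abs_nonneg _)),
    potential_abs hodd, potential_abs hodd]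
  unfold energy at h1
  linarith

lemma sqrt_flux_le (h : RadialProfile N g ξ u w) (hN : 1 ≤ N) (hgc : Continuous g)
    (hodd : ∀ s, g (-s) = -g s) (hpos : ∀ s, 0 < s → 0 < g s) {r : ℝ} (hr : 0 ≤ r) :
    √(1 + w r ^ 2) ≤ 1 + potential g ξ := by
  have h1 := h.energy_le hN hgc hr
  have h2 := potential_nonneg hgc hodd hpos (u r)
  unfold energy at h1
  linarith

lemma abs_flux_le (h : RadialProfile N g ξ u w) (hN : 1 ≤ N) (hgc : Continuous g)
    (hodd : ∀ s, g (-s) = -g s) (hpos : ∀ s, 0 < s → 0 < g s) {r : ℝ} (hr : 0 ≤ r) :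
    |w r| ≤ 1 + potential g ξ :=
  (Real.abs_le_sqrt (by linarith)).trans (h.sqrt_flux_le hN hgc hodd hpos hr)

/-! ### Oscillation -/

/-- A profile cannot be eventually positive: `arctan (-w / u)` would grow linearly. -/
lemma not_eventually_pos (h : RadialProfile N g ξ u w) (hN : 1 ≤ N) (hgc : Continuous g)
    (hodd : ∀ s, g (-s) = -g s) (hpos : ∀ s, 0 < s → 0 < g s) {k : ℝ} (hk : 0 < k)
    (hkg : ∀ s, 0 ≤ s → s ≤ |ξ| → k * s ≤ g s) (T : ℝ) :
    ¬ ∀ r, T ≤ r → 0 < u r := by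
  intro hu
  have hN1 : (1 : ℝ) ≤ N := by exact_mod_cast hN
  set B := 1 + potential g ξ with hBdef
  have hB : 0 < B := by have := potential_nonneg hgc hodd hpos ξ; linarith
  -- For `z = -w/u` the restoring and kinetic terms together give at least `m (1 + z²)`; beyond `N /
  -- m` the friction costs at most half of it.
  set m := min k (1 / B) with hm_def
  have hm : 0 < m := lt_min hk (by positivity)
  set T₁ := max T (N / m)
  have hT₁ : 0 < T₁ := lt_of_lt_of_le (by positivity) (le_max_right _ _)
  have hz : ∀ r, T₁ ≤ r → HasDerivAt (fun r => Real.arctan (-w r / u r))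
      (1 / (1 + (-w r / u r) ^ 2) *
        ((-(-g (u r) - ((N : ℝ) - 1) / r * w r) * u r - -w r * fluxInv (w r)) / u r ^ 2)) r :=
    fun r hr => ((h.hasDerivAt_flux r (hT₁.trans_le hr)).neg.div (h.hasDerivAt r)
      (hu r ((le_max_left _ _).trans hr)).ne').arctan
  have hbound : ∀ r, T₁ ≤ r → m / 2 ≤ 1 / (1 + (-w r / u r) ^ 2) *
        ((-(-g (u r) - ((N : ℝ) - 1) / r * w r) * u r - -w r * fluxInv (w r)) / u r ^ 2) := by
    intro r hr
    have hr0 : 0 < r := hT₁.trans_le hr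
    have hur := hu r ((le_max_left _ _).trans hr)
    obtain ⟨z, hz⟩ : ∃ z, z = -w r / u r := ⟨_, rfl⟩
    have hw : w r = -(z * u r) := by rw [hz]; field_simp
    have hgk : k ≤ g (u r) / u r := by
      rw [le_div_iff₀ hur]
      exact hkg _ hur.le ((le_abs_self _).trans (h.abs_value_le hN hgc hodd hpos hr0.le))
    have hsq := h.sqrt_flux_le hN hgc hodd hpos hr0.le
    have hflux : 1 / B * z ^ 2 ≤ w r * fluxInv (w r) / u r ^ 2 := by
      have h1 : w r * fluxInv (w r) / u r ^ 2 = 1 / √(1 + w r ^ 2) * z ^ 2 := by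
        rw [fluxInv, hz]
        field_simp
      rw [h1]
      exact mul_le_mul_of_nonneg_right
        (one_div_le_one_div_of_le (sqrt_one_add_sq_pos _) hsq) (sq_nonneg z)
    have hNr0 : 0 ≤ ((N : ℝ) - 1) / r := div_nonneg (by linarith) hr0.le
    have hNr : ((N : ℝ) - 1) / r ≤ m := by
      rw [div_le_iff₀ hr0]
      have : N / m ≤ r := (le_max_right _ _).trans hr
      rw [div_le_iff₀ hm] at this
      linarith
    have hmk : m ≤ k := min_le_left _ _
    have hmB : m * z ^ 2 ≤ 1 / B * z ^ 2 :=
      mul_le_mul_of_nonneg_right (min_le_right _ _) (sq_nonneg z)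
    have hexp : (-(-g (u r) - ((N : ℝ) - 1) / r * w r) * u r - -w r * fluxInv (w r)) / u r ^ 2
        = g (u r) / u r - ((N : ℝ) - 1) / r * z + w r * fluxInv (w r) / u r ^ 2 := by
      rw [hz]
      field_simp
      ring
    have hzz : ((N : ℝ) - 1) / r * z ≤ m * ((1 + z ^ 2) / 2) := by
      refine (mul_le_mul_of_nonneg_left (show z ≤ (1 + z ^ 2) / 2 by nlinarith [sq_nonneg (z - 1)])
        hNr0).trans (mul_le_mul_of_nonneg_right hNr (by positivity))
    rw [hexp, ← hz, one_div, ← div_eq_inv_mul, le_div_iff₀ (by positivity)]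
    linarith
  have hlin := (convex_Ici T₁).mul_sub_le_image_sub_of_le_deriv (C := m / 2)
    (fun r hr => (hz r hr).continuousAt.continuousWithinAt)
    (fun r hr => (hz r (interior_subset hr)).differentiableAt.differentiableWithinAt)
    (fun r hr => by rw [(hz r (interior_subset hr)).deriv]; exact hbound r (interior_subset hr))
    -- At speed `m / 2` the angle gains `π` over this length, but `arctan` takes values in an open
    -- interval of length `π`.
    T₁ self_mem_Ici (T₁ + 2 * Real.pi / m) (by
      have : 0 ≤ 2 * Real.pi / m := by positivity
      exact le_add_of_nonneg_right this)
    (le_add_of_nonneg_right (by positivity))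
  have h1 := Real.arctan_lt_pi_div_two (-w (T₁ + 2 * Real.pi / m) / u (T₁ + 2 * Real.pi / m))
  have h2 := Real.neg_pi_div_two_lt_arctan (-w T₁ / u T₁)
  have h3 : m / 2 * (T₁ + 2 * Real.pi / m - T₁) = Real.pi := by field_simp; ring
  simp only [h3] at hlin
  linarith

lemma exists_zero (h : RadialProfile N g ξ u w) (hN : 1 ≤ N) (hgc : Continuous g)
    (hodd : ∀ s, g (-s) = -g s) (hpos : ∀ s, 0 < s → 0 < g s) {k : ℝ} (hk : 0 < k)
    (hkg : ∀ s, 0 ≤ s → s ≤ |ξ| → k * s ≤ g s) (T : ℝ) :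
    ∃ r, T ≤ r ∧ u r = 0 := by
  have key : ∀ {ξ : ℝ} {u w : ℝ → ℝ}, RadialProfile N g ξ u w →
      (∀ s, 0 ≤ s → s ≤ |ξ| → k * s ≤ g s) → 0 ≤ u T → ∃ r, T ≤ r ∧ u r = 0 := by
    intro ξ u w h hkg hT0
    have := h.not_eventually_pos hN hgc hodd hpos hk hkg T
    push Not at this
    obtain ⟨r, hr, hur⟩ := this
    obtain ⟨x, hx, hx0⟩ := intermediate_value_Icc' hr h.continuous.continuousOn ⟨hur, hT0⟩
    exact ⟨x, hx.1, hx0⟩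
  rcases le_total 0 (u T) with h0 | h0
  · exact key h hkg h0
  · obtain ⟨r, hr, hr0⟩ := key (h.neg hodd) (by simpa using hkg) (by simpa using h0)
    exact ⟨r, hr, by simpa using hr0⟩

lemma isOscillating (h : RadialProfile N g ξ u w) (hN : 1 ≤ N) (hgc : Continuous g)
    (hodd : ∀ s, g (-s) = -g s) (hpos : ∀ s, 0 < s → 0 < g s) {k : ℝ} (hk : 0 < k)
    (hkg : ∀ s, 0 ≤ s → s ≤ |ξ| → k * s ≤ g s) : IsOscillating u := by
  choose z hz hz0 using fun n : ℕ => h.exists_zero hN hgc hodd hpos hk hkg n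
  refine ⟨z, fun n => ⟨(Nat.cast_nonneg n).trans (hz n), hz0 n⟩, ?_⟩
  rintro ⟨M, hM⟩
  obtain ⟨n, hn⟩ := exists_nat_gt M
  have := hM (mem_range_self n)
  linarith [hz n]

end RadialProfile

/-! ### Decay and the sup norm -/

namespace RadialProfile

variable {N : ℕ} {g : ℝ → ℝ} {ξ : ℝ} {u w : ℝ → ℝ}

/-- Both summands are nonnegative and vanish together only at `(0, 0)`, which the energy bound
excludes; the orbit lies in a compact set, so the minimum is positive. -/
lemma exists_dissipation_ge (h : RadialProfile N g ξ u w) (hN : 1 ≤ N) (hgc : Continuous g)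
    (hodd : ∀ s, g (-s) = -g s) (hpos : ∀ s, 0 < s → 0 < g s) {ε : ℝ} (hε : 0 < ε)
    (hE : ∀ r, 1 ≤ r → ε ≤ energy g u w r) :
    ∃ c, 0 < c ∧ ∀ r, 1 ≤ r → c ≤ w r * fluxInv (w r) + u r * g (u r) := by
  set B := 1 + potential g ξ
  have hpc := continuous_potential hgc
  have hfc := continuous_fluxInv
  have hK : IsCompact ((Icc (-|ξ|) |ξ| ×ˢ Icc (-B) B) ∩
      {p : ℝ × ℝ | ε ≤ √(1 + p.2 ^ 2) - 1 + potential g p.1}) :=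
    (isCompact_Icc.prod isCompact_Icc).inter_right (isClosed_le (by fun_prop) (by fun_prop))
  have hmem : ∀ r, 1 ≤ r → (u r, w r) ∈ ((Icc (-|ξ|) |ξ| ×ˢ Icc (-B) B) ∩
      {p : ℝ × ℝ | ε ≤ √(1 + p.2 ^ 2) - 1 + potential g p.1}) := fun r hr =>
    ⟨⟨abs_le.1 (h.abs_value_le hN hgc hodd hpos (by linarith)),
      abs_le.1 (h.abs_flux_le hN hgc hodd hpos (by linarith))⟩, hE r hr⟩
  obtain ⟨p, hp, hmin⟩ := hK.exists_isMinOn ⟨_, hmem 1 le_rfl⟩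
    (show Continuous fun p : ℝ × ℝ => p.2 * fluxInv p.2 + p.1 * g p.1 by fun_prop).continuousOn
  refine ⟨_, ?_, fun r hr => hmin (hmem r hr)⟩
  have hu : 0 ≤ p.1 * g p.1 := by
    rcases eq_or_ne p.1 0 with h0 | h0
    · simp [h0]
    · exact (mul_self_pos_of_odd hodd hpos h0).le
  rcases eq_or_ne p.2 0 with h0 | h0
  · have h1 : p.1 ≠ 0 := by
      intro h1
      have := hp.2
      simp only [mem_ofPred_eq, h0, h1, potential_zero] at this
      norm_num at this
      linarith
    have := mul_self_pos_of_odd hodd hpos h1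
    simpa [h0] using this
  · have : 0 < p.2 * fluxInv p.2 :=
      mul_self_pos_of_odd fluxInv_neg (fun _ => fluxInv_pos) h0
    positivity

/-- The energy gets arbitrarily small: otherwise `energy + u w / (2r)` would decrease
logarithmically. -/
lemma exists_energy_lt (h : RadialProfile N g ξ u w) (hN : 2 ≤ N) (hgc : Continuous g)
    (hodd : ∀ s, g (-s) = -g s) (hpos : ∀ s, 0 < s → 0 < g s) {ε : ℝ} (hε : 0 < ε) :
    ∃ r, 1 ≤ r ∧ energy g u w r < ε := by
  by_contra! hE
  have hN' : 1 ≤ N := by omega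
  have hN2 : (2 : ℝ) ≤ N := by exact_mod_cast hN
  obtain ⟨c, hc, hcle⟩ := h.exists_dissipation_ge hN' hgc hodd hpos hε hE
  set B := 1 + potential g ξ
  have huw : ∀ r, 0 ≤ r → |u r * w r| ≤ |ξ| * B := fun r hr => by
    rw [abs_mul]
    exact mul_le_mul (h.abs_value_le hN' hgc hodd hpos hr) (h.abs_flux_le hN' hgc hodd hpos hr)
      (abs_nonneg _) (abs_nonneg _)
  have hB0 : 0 ≤ |ξ| * B := (abs_nonneg _).trans (huw 0 le_rfl)
  -- The correction `u w / (2r)` trades half of `w * fluxInv w` for `u * g u`, leaving an error `N u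
  -- w / (2r²)` that `C / r` absorbs; `c / 2 * log r` uses up the dissipation bound.
  set C := (N : ℝ) / 2 * (|ξ| * B) with hC
  have hd : ∀ r, 0 < r → HasDerivAt
      (fun r => energy g u w r + u r * w r / (2 * r) + c / 2 * Real.log r + C * r⁻¹)
      (-(1 / (2 * r)) * ((2 * (N : ℝ) - 3) * (w r * fluxInv (w r)) + u r * g (u r) - c)
        - (N / 2 * (u r * w r) + C) / r ^ 2) r := by
    intro r hr
    have h1 := h.hasDerivAt_energy hgc hr
    have h2 := ((h.hasDerivAt r).mul (h.hasDerivAt_flux r hr)).div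
      ((hasDerivAt_id r).const_mul 2) (mul_pos two_pos hr).ne'
    have h3 := (Real.hasDerivAt_log hr.ne').const_mul (c / 2)
    have h4 := (hasDerivAt_inv hr.ne').const_mul C
    refine (((h1.add h2).add h3).add h4).congr_deriv ?_
    simp only [id, Pi.mul_apply]
    field_simp
    ring
  have hanti : AntitoneOn
      (fun r => energy g u w r + u r * w r / (2 * r) + c / 2 * Real.log r + C * r⁻¹) (Ici 1) := by
    have hpos' : ∀ r ∈ Ici (1 : ℝ), 0 < r := fun r hr => one_pos.trans_le hr
    refine antitoneOn_of_deriv_nonpos (convex_Ici 1)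
      (fun r hr => (hd r (hpos' r hr)).continuousAt.continuousWithinAt)
      (fun r hr => (hd r (hpos' r (interior_subset hr))).differentiableAt.differentiableWithinAt)
      fun r hr => ?_
    have hr1 : 1 ≤ r := interior_subset hr
    have hr0 : 0 < r := one_pos.trans_le hr1
    rw [(hd r hr0).deriv]
    have h1 := mul_fluxInv_nonneg (w r)
    have h2 := hcle r hr1
    -- Here `N ≥ 2` matters: `2N - 3 ≥ 1`, so the sum dominates `c`.
    have h3 : 0 ≤ (2 * (N : ℝ) - 3) * (w r * fluxInv (w r)) + u r * g (u r) - c := by nlinarith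
    have h4 : 0 ≤ N / 2 * (u r * w r) + C := by
      have := (abs_le.1 (huw r hr0.le)).1
      rw [hC, ← mul_add]
      exact mul_nonneg (by positivity) (by linarith)
    have h5 : 0 ≤ 1 / (2 * r) * ((2 * (N : ℝ) - 3) * (w r * fluxInv (w r)) + u r * g (u r) - c) :=
      mul_nonneg (by positivity) h3
    have h6 : 0 ≤ (N / 2 * (u r * w r) + C) / r ^ 2 := by positivity
    linarith
  have hlower : ∀ r, 1 ≤ r → c / 2 * Real.log r - |ξ| * B / 2 ≤
      energy g u w r + u r * w r / (2 * r) + c / 2 * Real.log r + C * r⁻¹ := by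
    intro r hr
    have hr0 : 0 < r := one_pos.trans_le hr
    have h1 : 0 ≤ energy g u w r := energy_nonneg hgc hodd hpos r
    have h2 : 0 ≤ C * r⁻¹ := by positivity
    have h3 : -(|ξ| * B / 2) ≤ u r * w r / (2 * r) := by
      rw [le_div_iff₀ (by positivity)]
      have := (abs_le.1 (huw r hr0.le)).1
      nlinarith
    linarith
  have htend : Tendsto (fun r => c / 2 * Real.log r - |ξ| * B / 2) atTop atTop :=
    tendsto_atTop_add_const_right _ _ (Real.tendsto_log_atTop.const_mul_atTop (by positivity))
  obtain ⟨r, hr, hr1⟩ := ((htend.eventually_gt_atTop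
    (energy g u w 1 + u 1 * w 1 / (2 * 1) + c / 2 * Real.log 1 + C * 1⁻¹)).and
    (eventually_ge_atTop 1)).exists
  have h1 := hanti self_mem_Ici hr1 hr1
  have h2 := hlower r hr1
  simp only at h1
  linarith

lemma tendsto_energy (h : RadialProfile N g ξ u w) (hN : 2 ≤ N) (hgc : Continuous g)
    (hodd : ∀ s, g (-s) = -g s) (hpos : ∀ s, 0 < s → 0 < g s) :
    Tendsto (energy g u w) atTop (𝓝 0) := by
  rw [Metric.tendsto_atTop]
  intro ε hε
  obtain ⟨r, hr, hrε⟩ := h.exists_energy_lt hN hgc hodd hpos hε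
  have hr0 : 0 ≤ r := zero_le_one.trans hr
  refine ⟨r, fun x hx => ?_⟩
  rw [Real.dist_eq, sub_zero, abs_of_nonneg (energy_nonneg hgc hodd hpos x)]
  exact (h.antitoneOn_energy (by omega) hgc hr0 (hr0.trans hx) hx).trans_lt hrε

lemma tendsto_value (h : RadialProfile N g ξ u w) (hN : 2 ≤ N) (hgc : Continuous g)
    (hodd : ∀ s, g (-s) = -g s) (hpos : ∀ s, 0 < s → 0 < g s) :
    Tendsto u atTop (𝓝 0) := by
  rw [Metric.tendsto_nhds]
  intro ε hε
  have hGε : 0 < potential g ε := by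
    simpa using strictMonoOn_potential hgc hpos self_mem_Ici hε.le hε
  filter_upwards [(h.tendsto_energy hN hgc hodd hpos).eventually_lt_const hGε] with r hr
  rw [Real.dist_eq, sub_zero,
    ← (strictMonoOn_potential hgc hpos).lt_iff_lt (mem_Ici.2 (abs_nonneg _)) (mem_Ici.2 hε.le), potential_abs hodd]
  have := one_le_sqrt_one_add_sq (w r)
  unfold energy at hr
  linarith

/-- As the potential is nonnegative, `√(1+w²) ≤ 1 + energy`. -/
lemma tendsto_flux (h : RadialProfile N g ξ u w) (hN : 2 ≤ N) (hgc : Continuous g)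
    (hodd : ∀ s, g (-s) = -g s) (hpos : ∀ s, 0 < s → 0 < g s) :
    Tendsto w atTop (𝓝 0) := by
  have h1 : Tendsto (fun r => √((1 + energy g u w r) ^ 2 - 1)) atTop (𝓝 0) := by
    have := ((((h.tendsto_energy hN hgc hodd hpos).const_add 1).pow 2).sub_const 1).sqrt
    simpa using this
  refine squeeze_zero_norm (fun r => Real.abs_le_sqrt ?_) h1
  have h2 := one_le_sqrt_one_add_sq (w r)
  have h3 := potential_nonneg hgc hodd hpos (u r)
  have h4 := sq_sqrt_one_add_sq (w r)
  unfold energy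
  nlinarith

lemma isLocalized (h : RadialProfile N g ξ u w) (hN : 2 ≤ N) (hgc : Continuous g)
    (hodd : ∀ s, g (-s) = -g s) (hpos : ∀ s, 0 < s → 0 < g s) : IsLocalized u := by
  have hu := h.tendsto_value hN hgc hodd hpos
  have hw := h.tendsto_flux hN hgc hodd hpos
  have hg0 : g 0 = 0 := by have := hodd 0; rw [neg_zero] at this; linarith
  intro k hk
  have hev : iteratedDeriv k u =ᶠ[atTop] iteratedDerivWithin k u (Ici 0) := by
    filter_upwards [eventually_ge_atTop 0] with r hr
    exact (iteratedDerivWithin_eq_iteratedDeriv (uniqueDiffOn_Ici 0)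
      (h.contDiff.of_le (by exact_mod_cast hk)).contDiffAt hr).symm
  refine Tendsto.congr' hev ?_
  interval_cases k
  · simpa using hu
  · rw [iteratedDeriv_one, h.deriv_eq]
    simpa [Function.comp_def] using (continuous_fluxInv.tendsto 0).comp hw
  · have hd : ∀ r, 0 < r → iteratedDeriv 2 u r =
        deriv fluxInv (w r) * (-g (u r) - ((N : ℝ) - 1) / r * w r) := fun r hr => by
      rw [iteratedDeriv_succ, iteratedDeriv_one, h.deriv_eq]
      exact (((contDiff_fluxInv (n := 1)).differentiable one_ne_zero
        (w r)).hasDerivAt.comp r (h.hasDerivAt_flux r hr)).deriv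
    have h1 : Tendsto (fun r => deriv fluxInv (w r)) atTop (𝓝 (deriv fluxInv 0)) :=
      ((contDiff_fluxInv.continuous_deriv le_rfl).tendsto 0).comp hw
    have h2 : Tendsto (fun r => g (u r)) atTop (𝓝 0) := by
      simpa [hg0, Function.comp_def] using (hgc.tendsto 0).comp hu
    have h3 : Tendsto (fun r : ℝ => ((N : ℝ) - 1) / r) atTop (𝓝 0) :=
      tendsto_const_nhds.div_atTop tendsto_id
    have h4 := h1.mul (h2.neg.sub (h3.mul hw))
    simp only [neg_zero, mul_zero, sub_zero] at h4
    refine h4.congr' ?_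
    filter_upwards [eventually_gt_atTop 0] with r hr
    exact (hd r hr).symm

lemma eLpNorm_top (h : RadialProfile N g ξ u w) (hu : ∀ r, 0 ≤ r → |u r| ≤ |ξ|) :
    eLpNorm u ⊤ (volume.restrict (Ici (0 : ℝ))) = ENNReal.ofReal |ξ| := by
  rw [eLpNorm_exponent_top]
  refine le_antisymm (eLpNormEssSup_le_of_ae_bound ?_) ?_
  · filter_upwards [ae_restrict_mem measurableSet_Ici] with r hr using hu r hr
  -- By continuity `|u|` is close to `|ξ|` just right of `0`, so the open set where it exceeds a
  -- smaller essential supremum would be null yet nonempty.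
  · by_contra! hlt
    set c := eLpNormEssSup u (volume.restrict (Ici (0 : ℝ)))
    have hopen : IsOpen (Ioi (0 : ℝ) ∩ {r | c < ‖u r‖ₑ}) :=
      isOpen_Ioi.inter (isOpen_lt continuous_const h.continuous.enorm)
    have hnull : volume (Ioi (0 : ℝ) ∩ {r | c < ‖u r‖ₑ}) = 0 := by
      have hae := ae_le_eLpNormEssSup (f := u) (μ := volume.restrict (Ici (0 : ℝ)))
      rw [ae_restrict_iff' measurableSet_Ici, ae_iff] at hae
      refine measure_mono_null (fun r hr => ?_) hae
      simp only [mem_ofPred_eq, Classical.not_imp, not_le]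
      exact ⟨mem_Ici.2 (le_of_lt (mem_Ioi.1 hr.1)), hr.2⟩
    rw [hopen.measure_eq_zero_iff volume] at hnull
    have hev : ∀ᶠ r in 𝓝[>] (0 : ℝ), c < ‖u r‖ₑ := by
      refine (h.continuous.enorm.tendsto 0).mono_left nhdsWithin_le_nhds |>.eventually_const_lt ?_
      rwa [h.value_zero, Real.enorm_eq_ofReal_abs]
    obtain ⟨r, hr, hr0⟩ := (hev.and self_mem_nhdsWithin).exists
    exact (hnull ▸ (⟨hr0, hr⟩ : r ∈ Ioi (0 : ℝ) ∩ {r | c < ‖u r‖ₑ}) : r ∈ (∅ : Set ℝ))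

end RadialProfile

/-! ### Truncation and the three cases -/

/-- The quotient `g s / s`, extended by `g'(0)` at `0`, is continuous and positive on `[0, a]`, so
it attains a positive minimum. -/
lemma exists_pos_mul_le_of_deriv_pos {g : ℝ → ℝ} (hgc : Continuous g) (hg0 : g 0 = 0)
    (hd : DifferentiableAt ℝ g 0) (hd' : 0 < deriv g 0) {a : ℝ} (ha : 0 ≤ a)
    (hpos : ∀ s, 0 < s → 0 < g s) : ∃ k, 0 < k ∧ ∀ s, 0 ≤ s → s ≤ a → k * s ≤ g s := by
  have hc : Continuous (dslope g 0) := by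
    refine continuous_iff_continuousAt.2 fun s => ?_
    rcases eq_or_ne s 0 with rfl | hs
    · exact continuousAt_dslope_same.2 hd
    · exact (continuousAt_dslope_of_ne hs).2 hgc.continuousAt
  obtain ⟨s₀, hs₀, hmin⟩ := (isCompact_Icc (a := 0) (b := a)).exists_isMinOn
    ⟨0, le_rfl, ha⟩ hc.continuousOn
  refine ⟨dslope g 0 s₀, ?_, fun s hs hsa => ?_⟩
  · rcases hs₀.1.eq_or_lt with h | h
    · rw [← h, dslope_same]; exact hd'
    · rw [dslope_of_ne _ h.ne', slope_def_field, hg0]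
      have := hpos s₀ h
      simp only [sub_zero]
      positivity
  · have h1 : dslope g 0 s₀ ≤ dslope g 0 s := hmin ⟨hs, hsa⟩
    have h2 := sub_smul_dslope g 0 s
    rw [hg0, sub_zero, sub_zero, smul_eq_mul, mul_comm] at h2
    rw [← h2]
    exact mul_le_mul_of_nonneg_right h1 hs

/-- Profiles starting below the positive zero of `g` oscillate and decay. -/
theorem exists_radialProfile_isOscillating {N : ℕ} (hN : 2 ≤ N) {g : ℝ → ℝ} (hgc : Continuous g)
    (hodd : ∀ s, g (-s) = -g s) {ξ : ℝ} (hξ : 0 < |ξ|) (hpos : ∀ s, 0 < s → s ≤ |ξ| → 0 < g s)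
    (hd : DifferentiableAt ℝ g 0) (hd' : 0 < deriv g 0) :
    ∃ u w : ℝ → ℝ, RadialProfile N g ξ u w ∧ IsOscillating u ∧ IsLocalized u ∧
      ∀ r, 0 ≤ r → |u r| ≤ |ξ| := by
  set a := |ξ|
  have hN' : 1 ≤ N := by omega
  have hg0 : g 0 = 0 := by have := hodd 0; rw [neg_zero] at this; linarith
  -- Clamping the argument to `[-a, a]` keeps oddness and makes `G` positive on all of `(0, ∞)`; the
  -- bound `|u| ≤ a` then returns to `g`.
  obtain ⟨G, hG⟩ : ∃ G : ℝ → ℝ, G = fun s => g (max (-a) (min a s)) := ⟨_, rfl⟩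
  have hGc : Continuous G := by rw [hG]; fun_prop
  have hGeq : ∀ s, |s| ≤ a → G s = g s := fun s hs => by
    rw [abs_le] at hs
    rw [hG]
    simp only [min_eq_right hs.2, max_eq_right hs.1]
  have hGodd : ∀ s, G (-s) = -G s := fun s => by
    have : max (-a) (min a (-s)) = -max (-a) (min a s) := by
      rw [← min_neg_neg, ← max_neg_neg, neg_neg, max_min_distrib_left,
        max_eq_right (show -a ≤ a by linarith)]
    rw [hG, ← hodd, ← this]
  have hGpos : ∀ s, 0 < s → 0 < G s := fun s hs => by
    have h1 : 0 < min a s := lt_min hξ hs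
    rw [hG]
    simp only [max_eq_right (show -a ≤ min a s by linarith)]
    exact hpos _ h1 (min_le_left _ _)
  have hev : G =ᶠ[𝓝 0] g := by
    filter_upwards [Metric.ball_mem_nhds (0 : ℝ) hξ] with s hs
    rw [mem_ball_zero_iff] at hs
    exact hGeq s hs.le
  obtain ⟨k, hk, hkG⟩ := exists_pos_mul_le_of_deriv_pos hGc
    ((hGeq 0 (by simpa using hξ.le)).trans hg0) (hev.differentiableAt_iff.2 hd)
    (hev.deriv_eq ▸ hd') hξ.le hGpos
  obtain ⟨u, w, h⟩ := exists_radialProfile hN' hGc ξ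
  have hle : ∀ r, 0 ≤ r → |u r| ≤ a := fun r hr => h.abs_value_le hN' hGc hGodd hGpos hr
  exact ⟨u, w, h.congr fun r hr => (hGeq _ (hle r hr)).symm,
    h.isOscillating hN' hGc hGodd hGpos hk hkG, h.isLocalized hN hGc hGodd hGpos, hle⟩

lemma eq_zero_of_pos_left_of_neg_right {g : ℝ → ℝ} (hgc : Continuous g) {a : ℝ} (ha : 0 < a)
    (hpos : ∀ s, 0 < s → s < a → 0 < g s) (hneg : ∀ s, a < s → g s < 0) : g a = 0 := by
  refine le_antisymm ?_ ?_
  · refine le_of_tendsto ((hgc.tendsto a).mono_left nhdsWithin_le_nhds : Tendsto g (𝓝[>] a) _) ?_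
    filter_upwards [self_mem_nhdsWithin] with s hs using (hneg s hs).le
  · refine ge_of_tendsto ((hgc.tendsto a).mono_left nhdsWithin_le_nhds : Tendsto g (𝓝[<] a) _) ?_
    filter_upwards [Ioo_mem_nhdsLT ha] with s hs using (hpos s hs.1 hs.2).le

theorem mainTheorem4 (N : ℕ) (hN : 2 ≤ N) (g : ℝ → ℝ) (α : EReal) (hα : 0 < α)
    (hg_cont : Continuous g) (hg_odd : ∀ s, g (-s) = -g s)
    (hg_pos : ∀ s : ℝ, 0 < s → (s : EReal) < α → 0 < g s)
    (hg_neg : ∀ s : ℝ, α < (s : EReal) → g s < 0)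
    (hg_diff : DifferentiableAt ℝ g 0) (hg_deriv : 0 < deriv g 0) (ξ : ℝ) :
    ∃ (R : EReal) (u : ℝ → ℝ), IsMaximalRadialSolution N g ξ R u ∧
      -- the stationary case
      (((|ξ| : ℝ) : EReal) = α ∨ ξ = 0 → ∀ r ∈ halfOpen R, u r = ξ) ∧
      -- the monotone unbounded case
      (α < ((|ξ| : ℝ) : EReal) →
        StrictMonoOn (fun r => |u r|) (halfOpen R) ∧
        Tendsto (fun r => |u r|) (leftEnd R) atTop) ∧
      -- the oscillating case
      (0 < |ξ| → ((|ξ| : ℝ) : EReal) < α →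
        R = ⊤ ∧ IsOscillating u ∧ IsLocalized u ∧
        eLpNorm u ⊤ (volume.restrict (Ici (0 : ℝ))) = ENNReal.ofReal |ξ|) := by
  have hg0 : g 0 = 0 := by have := hg_odd 0; rw [neg_zero] at this; linarith
  by_cases hstat : ((|ξ| : ℝ) : EReal) = α ∨ ξ = 0
  · have hξ : g ξ = 0 := by
      rcases hstat with rfl | rfl
      · have ha : g |ξ| = 0 := eq_zero_of_pos_left_of_neg_right hg_cont
          (by exact_mod_cast hα) (fun s hs hsa => hg_pos s hs (by exact_mod_cast hsa))
          (fun s hs => hg_neg s (by exact_mod_cast hs))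
        rcases abs_choice ξ with h | h
        · rwa [h] at ha
        · rw [h, hg_odd] at ha; linarith
      · exact hg0
    refine ⟨⊤, _, (radialProfile_const hξ).isMaximalRadialSolution, fun _ _ _ => rfl,
      fun hlt => ?_, fun hpos hlt => ?_⟩
    · rcases hstat with h | rfl
      · exact absurd h hlt.ne'
      · simp only [abs_zero, EReal.coe_zero] at hlt
        exact absurd hlt hα.not_gt
    · rcases hstat with h | rfl
      · exact absurd h hlt.ne
      · simp at hpos
  have hξ0 : 0 < |ξ| := abs_pos.2 fun h => hstat (Or.inr h)
  rcases lt_or_gt_of_ne fun h => hstat (Or.inl h) with hlt | hgt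
  · obtain ⟨u, w, h, hosc, hloc, hle⟩ := exists_radialProfile_isOscillating hN hg_cont hg_odd hξ0
      (fun s hs hsξ => hg_pos s hs (lt_of_le_of_lt (by exact_mod_cast hsξ) hlt)) hg_diff hg_deriv
    exact ⟨⊤, u, h.isMaximalRadialSolution, fun hs => absurd hs hstat,
      fun hgt => absurd hgt hlt.not_gt, fun _ _ => ⟨rfl, hosc, hloc, h.eLpNorm_top hle⟩⟩
  · obtain ⟨u, w, h, hupos, hmono, htend⟩ := exists_radialProfile_strictMonoOn hN hg_cont hξ0
      fun s hs => hg_neg s (lt_of_lt_of_le hgt (by exact_mod_cast hs))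
    -- The profile `u` starts at `|ξ|`; oddness of `g` reflects it when `ξ < 0`.
    obtain ⟨v, z, hv, habs⟩ : ∃ v z : ℝ → ℝ, RadialProfile N g ξ v z ∧ ∀ r, |v r| = |u r| := by
      rcases abs_choice ξ with hξ | hξ
      · exact ⟨u, w, hξ ▸ h, fun _ => rfl⟩
      · refine ⟨-u, -w, ?_, fun r => abs_neg _⟩
        have := h.neg hg_odd
        rwa [hξ, neg_neg] at this
    refine ⟨⊤, v, hv.isMaximalRadialSolution, fun hs => absurd hs hstat, fun _ => ⟨?_, ?_⟩,
      fun _ hlt => absurd hlt hgt.not_gt⟩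
    · rw [halfOpen_top]
      exact hmono.congr fun r hr => by rw [habs, abs_of_pos (hupos r hr)]
    · rw [leftEnd_top]
      simp only [habs]
      exact tendsto_abs_atTop_atTop.comp htend
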